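/- Let $L$ be a countable first-order language and $T$ a set of $L$-sentences. All structures are nonempty, and $N \subseteq M$ means that $N$ is a (nonempty) substructure of $M$. Then $T$ has the strong Shoenfield property if and only if $T$ has the van den Dries property. Here $T$ has the **strong Shoenfield property** if 1. for all $M_1, M_2 \models T$, all substructures $N_1 \subseteq M_1$, $N_2 \subseteq M_2$ and every isomorphism $f : N_1 \to N_2$, there are substructures $N_1^*, N_2^* \models T$ with $N_1 \subseteq N_1^* \subseteq M_1$ and $N_2 \subseteq N_2^* \subseteq M_2$ and an isomorphism $f^* : N_1^* \to N_2^*$ extending $f$; and 2. for all $N, M \models T$ with $N \subseteq M$, every existential formula $\varphi(\bar x)$ and every tuple $\bar b$ from $N$, $M \models \varphi(\bar b)$ if and only if $N \models \varphi(\bar b)$ (that is, $T$ is model complete). And $T$ has the **van den Dries property** if 1. every structure $N$ that is a substructure of some model of $T$ has a $T$-closure, that is, a model $N^* \models T$ with $N \subseteq N^*$ such that $N^*$ can be embedded over $N$ into every model $P \models T$ with $N \subseteq P$; and 2. whenever $N, M \models T$ and $N \subsetneq M$, there is an $a \in M \setminus N$ such that $N + a$, the smallest substructure of $M$ containing $N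 \cup \{a\}$, can be embedded over $N$ into an elementary extension of $N$. -/

import Mathlib

open FirstOrder FirstOrder.Language

universe u v w

namespace QETests

variable {L : FirstOrder.Language.{u, v}}

/-- The strong Shoenfield property. Models of a theory are nonempty structures
(`Theory.ModelType` is the type of nonempty models), and so are their submodels. -/
structure StrongShoenfieldProperty (T : L.Theory) : Prop where
  /-- An isomorphism between submodels of two models of `T` extends to an isomorphism between
  submodels which are themselves models of `T`. -/
  extend_iso : ∀ (M₁ M₂ : Theory.ModelType.{u, v, w} T)
    (N₁ : L.Substructure M₁) (N₂ : L.Substructure M₂), Nonempty N₁ → Nonempty N₂ →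
    ∀ f : N₁ ≃[L] N₂,
      ∃ (N₁' : L.Substructure M₁) (N₂' : L.Substructure M₂)
        (h₁ : N₁ ≤ N₁') (h₂ : N₂ ≤ N₂') (f' : N₁' ≃[L] N₂'),
        N₁' ⊨ T ∧ N₂' ⊨ T ∧
          ∀ x : N₁, f' (Substructure.inclusion h₁ x) = Substructure.inclusion h₂ (f x)
  /-- Existential formulas are absolute between a model of `T` and a submodel of it which is
  also a model of `T`. -/
  existential_absolute : ∀ (M : Theory.ModelType.{u, v, w} T) (N : L.Substructure M),
    Nonempty N → N ⊨ T →
    ∀ (n : ℕ) (φ : L.Formula (Fin n)), φ.IsExistential →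
      ∀ b : Fin n → N, φ.Realize (fun i => (b i : M)) ↔ φ.Realize b

/-- The model `C` of `T`, viewed as an extension of the structure `N` along the embedding `i`, is
a `T`-closure of `N`: it embeds over `N` into every model of `T` extending `N`. -/
def IsTClosure (T : L.Theory) {N : Type w} [L.Structure N]
    (C : Theory.ModelType.{u, v, w} T) (i : N ↪[L] C) : Prop :=
  ∀ (P : Theory.ModelType.{u, v, w} T) (g : N ↪[L] P),
    ∃ h : C ↪[L] P, ∀ x : N, h (i x) = g x

/-- `N + a`: the smallest substructure containing `N` and `a`. -/
def adjoin {M : Type w} [L.Structure M] (N : L.Substructure M) (a : M) : L.Substructure M :=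
  Substructure.closure L (insert a (N : Set M))

theorem le_adjoin {M : Type w} [L.Structure M] (N : L.Substructure M) (a : M) :
    N ≤ adjoin N a :=
  fun _ hx => Substructure.subset_closure (Set.mem_insert_of_mem a hx)

/-- The van den Dries property. -/
structure VanDenDriesProperty (T : L.Theory) : Prop where
  /-- Every (nonempty) structure which is a submodel of some model of `T` has a `T`-closure. -/
  exists_closure : ∀ (N : Type w) [L.Structure N] [Nonempty N],
    (∃ M : Theory.ModelType.{u, v, w} T, Nonempty (N ↪[L] M)) →
      ∃ (C : Theory.ModelType.{u, v, w} T) (i : N ↪[L] C), IsTClosure T C i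
  /-- If `N` is a proper submodel of `M` and both are models of `T`, then, for some `a` in `M`
  outside `N`, the structure `N + a` embeds over `N` into an elementary extension of `N`. -/
  exists_adjoin_embedding : ∀ (M : Theory.ModelType.{u, v, w} T) (N : L.Substructure M),
    Nonempty N → N ⊨ T → N ≠ ⊤ →
      ∃ a : M, a ∉ N ∧
        ∃ (E : Type w) (_ : L.Structure E) (e : N ↪ₑ[L] E) (g : adjoin N a ↪[L] E),
          ∀ x : N, g (Substructure.inclusion (le_adjoin N a) x) = e x

end QETests

/-!
The two directions are of quite different depth.

*From van den Dries to Shoenfield.* Embedding the `T`-closure of `N₁` in `M₁` and, along the given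
isomorphism, in `M₂` gives the isomorphic submodels. For the absoluteness of existential formulas
between models `N ⊆ M`, take by Zorn's lemma a maximal `K` between `N` and `M` in which `N` is
existentially closed (`ExistentiallyClosedIn`); by compactness this means that `K` embeds over `N`
in an elementary extension of `N`. Embedding the `T`-closure of `K` in that extension shows that
`K` is a model of `T`, and then the second half of the van den Dries property shows that `K = M`
(`VanDenDriesProperty.existentiallyClosedIn_top`).

*From Shoenfield to van den Dries.* Robinson's test makes all embeddings between models of `T`
elementary, so the second half of the van den Dries property holds with `M` as the elementary
extension of `N`. Moreover a nonempty common substructure of two models has the same type in both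
(`StrongShoenfieldProperty.sameType_of_embeddings`). A `T`-closure of `N ⊆ M` is found as a
constructible model over `N`: a transfinite sequence in `M` in which each element has isolated type
over `N` and the earlier elements, continued until it is an elementary substructure `C`
(`exists_construction`). As isolated types are realized in every model, the inclusion of `N` in
another model of `T` extends to `C` step by step (`exists_sameType_initialFamily`).

For the sequence to reach an elementary substructure, isolated types must be dense over every set
of parameters in a model of `T`. For countably many parameters this follows from an omitting types
theorem (`exists_elementary_omitting`): were there no isolated type below a formula `φ`, some model
would omit all the types below `φ` realized in a given countable model, and these two models would
have no common submodel over the parameters. The step to arbitrary sets of parameters is a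
closing-off argument, which like the omitting of types needs the language to be countable
(`exists_isolatedOver_of_sequences`).
-/

namespace QETests

open Set Filter

variable {L : FirstOrder.Language.{u, v}}

/-! ### Finite supports of formulas, families with the same type -/

/-- Used to replace an arbitrary index type of variables by some `Fin (n + 1)` without changing a
formula whose free variables lie in `F`: relabel along `g`, then substitute along `t`. -/
theorem exists_fin_retraction {α : Type*} [Nonempty α] (F : Finset α) :
    ∃ (n : ℕ) (g : α → Fin (n + 1)) (t : Fin (n + 1) → α), ∀ i ∈ F, t (g i) = i := by
  classical
  obtain ⟨d⟩ := ‹Nonempty α›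
  obtain ⟨n, hn⟩ : ∃ n, (insert d F).card = n + 1 :=
    ⟨_, (Nat.succ_pred_eq_of_pos (Finset.card_pos.2 ⟨d, Finset.mem_insert_self d F⟩)).symm⟩
  let e := (insert d F).equivFinOfCardEq hn
  refine ⟨n, fun i => if h : i ∈ insert d F then e ⟨i, h⟩ else 0, fun j => (e.symm j).1, ?_⟩
  intro i hi
  simp [Finset.mem_insert_of_mem hi]

theorem realize_congr_of_eqOn {M : Type*} [L.Structure M] {α : Type*} [DecidableEq α]
    (φ : L.Formula α) {x y : α → M} (h : ∀ i ∈ φ.freeVarFinset, x i = y i) :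
    φ.Realize x ↔ φ.Realize y := by
  have h₁ : Formula.Realize (φ.restrictFreeVar id) (fun i => x i.1) ↔ φ.Realize x :=
    BoundedFormula.realize_restrictFreeVar x fun _ => rfl
  have h₂ : Formula.Realize (φ.restrictFreeVar id) (fun i => x i.1) ↔ φ.Realize y :=
    BoundedFormula.realize_restrictFreeVar y fun a => h a.1 a.2
  exact h₁.symm.trans h₂

variable (L) in
/-- The families `x` in `M` and `y` in `P` have the same (complete, parameter-free) type. Since the
index type is arbitrary, this also expresses that the assignment `x i ↦ y i` is a partial
elementary map from `M` to `P`. -/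
def SameType {ι M P : Type*} [L.Structure M] [L.Structure P] (x : ι → M) (y : ι → P) : Prop :=
  ∀ φ : L.Formula ι, φ.Realize x ↔ φ.Realize y

section SameType

variable {ι κ M P Q : Type*} [L.Structure M] [L.Structure P] [L.Structure Q]
  {x : ι → M} {y : ι → P} {z : ι → Q}

theorem SameType.comp (h : SameType L x y) (f : κ → ι) : SameType L (x ∘ f) (y ∘ f) := fun φ => by
  simpa only [Formula.realize_relabel] using h (φ.relabel f)

theorem SameType.symm (h : SameType L x y) : SameType L y x := fun φ => (h φ).symm

theorem SameType.trans (h : SameType L x y) (h' : SameType L y z) : SameType L x z :=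
  fun φ => (h φ).trans (h' φ)

theorem sameType_of_forall_fin
    (h : ∀ (n : ℕ) (f : Fin n → ι), SameType L (x ∘ f) (y ∘ f)) : SameType L x y := by
  classical
  intro φ
  let e := φ.freeVarFinset.equivFin
  have key := h _ (fun j => (e.symm j).1) (φ.restrictFreeVar e)
  have h₁ : Formula.Realize (φ.restrictFreeVar e) (x ∘ fun j => (e.symm j).1) ↔ φ.Realize x :=
    BoundedFormula.realize_restrictFreeVar x fun a => by simp
  have h₂ : Formula.Realize (φ.restrictFreeVar e) (y ∘ fun j => (e.symm j).1) ↔ φ.Realize y :=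
    BoundedFormula.realize_restrictFreeVar y fun a => by simp
  exact h₁.symm.trans (key.trans h₂)

theorem SameType.eq_iff (h : SameType L x y) (i j : ι) : x i = x j ↔ y i = y j := by
  simpa [Formula.realize_equal] using h (Term.equal (Term.var i) (Term.var j))

theorem _root_.FirstOrder.Language.ElementaryEmbedding.sameType (e : M ↪ₑ[L] P) (x : ι → M) :
    SameType L x (e ∘ x) := fun φ => (e.map_formula φ x).symm

end SameType

/-! ### Realizing finitely satisfiable sets of formulas in elementary extensions -/

theorem small_formula [Countable L.Symbols] (α : Type*) [Small.{w} α] :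
    Small.{w} (L.Formula α) := by
  have hF : Countable (Σ l, L.Functions l) :=
    (Sum.inl_injective (β := Σ l, L.Relations l)).countable (β := L.Symbols)
  have hR : Countable (Σ l, L.Relations l) :=
    (Sum.inr_injective (α := Σ l, L.Functions l)).countable (β := L.Symbols)
  have hF' := Countable.toSmall.{w} (Σ l, L.Functions l)
  have hR' := Countable.toSmall.{w} (Σ l, L.Relations l)
  have hT : ∀ k : ℕ, Small.{w} (L.Term (α ⊕ Fin k)) := fun k =>
    small_of_injective Term.listEncode_injective
  have hB : Small.{w} (Σ n, L.BoundedFormula α n) :=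
    small_of_injective (BoundedFormula.encoding (L := L) (α := α)).encode_injective
  refine small_of_injective (f := fun φ : L.Formula α => (⟨0, φ⟩ : Σ n, L.BoundedFormula α n)) ?_
  exact fun φ ψ h => eq_of_heq (Sigma.mk.inj h).2

/-- The compactness theorem, relative to the elementary diagram of `N`: a set of formulas with
parameters in `N` which is finitely satisfiable in `N` is satisfied in an ultrapower of `N`, which
lives in the same universe as `N` because there are few formulas. -/
theorem exists_elementaryExtension_realizing [Countable L.Symbols] {N : Type w} [L.Structure N]
    [Nonempty N] {α : Type*} [Small.{w} α] (Γ : Set (L.Formula (N ⊕ α)))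
    (h : ∀ Γ₀ : Finset (L.Formula (N ⊕ α)), ↑Γ₀ ⊆ Γ →
      ∃ s : α → N, ∀ γ ∈ Γ₀, γ.Realize (Sum.elim id s)) :
    ∃ (E : Type w) (_ : L.Structure E) (e : N ↪ₑ[L] E) (s : α → E),
      ∀ γ ∈ Γ, γ.Realize (Sum.elim e s) := by
  classical
  have hsmall := small_formula.{u, v, w} (L := L) (N ⊕ α)
  let I := Finset (Shrink.{w} Γ)
  let U : Ultrafilter I := Ultrafilter.of atTop
  have hU : ∀ i₀ : I, ∀ᶠ i in (U : Filter I), i₀ ≤ i := fun i₀ =>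
    Ultrafilter.of_le _ (eventually_ge_atTop i₀)
  choose s hs using fun i : I => h (i.image fun γ => ((equivShrink Γ).symm γ).1) (by
    intro γ hγ
    obtain ⟨γ', -, rfl⟩ := Finset.mem_image.1 (Finset.mem_coe.1 hγ)
    exact ((equivShrink Γ).symm γ').2)
  let E := (U : Filter I).Product (fun _ => N)
  refine ⟨E, inferInstance, ⟨fun n => ((fun _ => n : I → N) : E), ?_⟩,
    fun a => ((fun i => s i a : I → N) : E), ?_⟩
  · intro n φ x
    have := Ultraproduct.realize_formula_cast (M := fun _ : I => N) (u := U) φ (fun j _ => x j)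
    refine this.trans ?_
    simp
  · intro γ hγ
    have := Ultraproduct.realize_formula_cast (M := fun _ : I => N) (u := U) γ
      (Sum.elim (fun n _ => n) (fun a i => s i a))
    have hfun : (Sum.elim (fun n => ((fun _ => n : I → N) : E))
        (fun a => ((fun i => s i a : I → N) : E))) =
        fun j => ((Sum.elim (fun n _ => n) (fun a i => s i a) j : I → N) : E) := by
      funext j
      cases j <;> rfl
    change γ.Realize (Sum.elim (fun n => ((fun _ => n : I → N) : E)) _)
    rw [hfun]
    refine this.2 ((hU {equivShrink Γ ⟨γ, hγ⟩}).mono fun i hi => ?_)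
    have := hs i γ (Finset.mem_image.2 ⟨equivShrink Γ ⟨γ, hγ⟩, hi (Finset.mem_singleton_self _),
      by simp⟩)
    convert this using 1
    funext j
    cases j <;> rfl

end QETests

namespace QETests

open Set

variable {L : FirstOrder.Language.{u, v}}

/-! ### Existentially closed embeddings -/

theorem _root_.FirstOrder.Language.BoundedFormula.IsQF.realize_formula_embedding
    {A B α : Type*} [L.Structure A] [L.Structure B] {φ : L.Formula α}
    (h : BoundedFormula.IsQF φ) (f : A ↪[L] B) {v : α → A} :
    φ.Realize (f ∘ v) ↔ φ.Realize v := by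
  have := h.realize_embedding f (v := v) (xs := default)
  rwa [Unique.eq_default (f ∘ default)] at this

theorem _root_.FirstOrder.Language.BoundedFormula.IsExistential.realize_formula_embedding
    {A B α : Type*} [L.Structure A] [L.Structure B] {φ : L.Formula α}
    (h : BoundedFormula.IsExistential φ) (f : A ↪[L] B) {v : α → A} (hv : φ.Realize v) :
    φ.Realize (f ∘ v) := by
  have := h.realize_embedding f (v := v) (xs := default) hv
  rwa [Unique.eq_default (f ∘ default)] at this

theorem _root_.FirstOrder.Language.BoundedFormula.IsExistential.exs {α : Type*} {n : ℕ}
    {φ : L.BoundedFormula α n} (h : φ.IsExistential) : BoundedFormula.IsExistential φ.exs := by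
  induction n with
  | zero => exact h
  | succ n ih => exact ih h.ex

theorem exists_qf_conjunction {α : Type*} (Γ : Finset (L.Formula α))
    (hΓ : ∀ γ ∈ Γ, BoundedFormula.IsQF γ) :
    ∃ χ : L.Formula α, BoundedFormula.IsQF χ ∧
      ∀ {A : Type w} [L.Structure A] (x : α → A), χ.Realize x ↔ ∀ γ ∈ Γ, γ.Realize x := by
  classical
  induction Γ using Finset.induction_on with
  | empty => exact ⟨⊤, BoundedFormula.IsQF.top, fun x => by simp [Formula.Realize]⟩
  | insert γ Γ _ ih =>
    obtain ⟨χ, hχ, h⟩ := ih fun γ' h' => hΓ γ' (Finset.mem_insert_of_mem h')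
    refine ⟨γ ⊓ χ, (hΓ γ (Finset.mem_insert_self _ _)).inf hχ, fun x => ?_⟩
    rw [Formula.realize_inf, h, Finset.forall_mem_insert]

/-- A map preserving quantifier-free formulas is an embedding. -/
theorem exists_embedding_of_qf {K E : Type*} [L.Structure K] [L.Structure E] (s : K → E)
    (h : ∀ γ : L.Formula K, BoundedFormula.IsQF γ → γ.Realize id → γ.Realize s) :
    ∃ g : K ↪[L] E, ∀ x, g x = s x := by
  refine ⟨⟨⟨s, fun x y hxy => ?_⟩, fun {n} f x => ?_, fun {n} r x => ⟨fun hr => ?_, fun hr => ?_⟩⟩,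
    fun _ => rfl⟩
  · by_contra hne
    refine h (∼(Term.equal (Term.var x) (Term.var y)))
      (BoundedFormula.IsAtomic.equal _ _).isQF.not ?_ ?_
    · simpa [Formula.realize_not] using hne
    · exact Formula.realize_equal.2 hxy
  · have := h (Term.equal (Term.func f fun i => Term.var (x i)) (Term.var (Structure.funMap f x)))
      (BoundedFormula.IsAtomic.equal _ _).isQF (by simp [Term.realize])
    simpa [Term.realize, Function.comp_def] using this.symm
  · by_contra hne
    refine h (∼(r.formula fun i => Term.var (x i)))
      (BoundedFormula.IsAtomic.rel _ _).isQF.not ?_ ?_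
    · rw [Formula.realize_not, Formula.realize_rel]
      exact hne
    · exact Formula.realize_rel.2 hr
  · have := h (r.formula fun i => Term.var (x i)) (BoundedFormula.IsAtomic.rel _ _).isQF
      (by rw [Formula.realize_rel]; exact hr)
    rw [Formula.realize_rel] at this
    exact this

/-- `N` is existentially closed in the part `K` of its extension `M`: a quantifier-free formula with
parameters in `N` which is satisfied in `M` by a tuple from `K` is satisfied in `N`. Only tuples are
restricted to `K`, formulas being evaluated in `M`, so that the property is inherited by unions of
chains of sets `K`. -/
def ExistentiallyClosedIn {N M : Type*} [L.Structure N] [L.Structure M] (i : N ↪[L] M)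
    (K : Set M) : Prop :=
  ∀ (n : ℕ) (γ : L.Formula (N ⊕ Fin n)), BoundedFormula.IsQF γ → ∀ x : Fin n → M,
    (∀ j, x j ∈ K) → γ.Realize (Sum.elim i x) → ∃ y : Fin n → N, γ.Realize (Sum.elim id y)

/-- If `K` embeds over `N` in an elementary extension `E` of `N`, then `N` is existentially closed
in `K`. -/
theorem ExistentiallyClosedIn.of_embedding {N M C E : Type*} [L.Structure N] [L.Structure M]
    [L.Structure C] [L.Structure E] {i : N ↪[L] M} {K : Set M} (p : C ↪[L] M) (q : C ↪[L] E)
    (e : N ↪ₑ[L] E) (k : N → C) (hp : ∀ n, p (k n) = i n) (hq : ∀ n, q (k n) = e n)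
    (hK : K ⊆ range p) : ExistentiallyClosedIn i K := by
  intro n γ hγ x hx h
  choose c hc using fun j => hK (hx j)
  have h₁ : Sum.elim i x = p ∘ Sum.elim k c := by
    funext a
    cases a <;> simp [hp, hc]
  rw [h₁, hγ.realize_formula_embedding, ← hγ.realize_formula_embedding q] at h
  have h₂ : q ∘ Sum.elim k c = Sum.elim (e ∘ id) (q ∘ c) := by
    funext a
    cases a <;> simp [hq]
  rw [h₂] at h
  have h₃ : (γ.iExs (Fin n)).Realize (e ∘ id) := Formula.realize_iExs.2 ⟨_, h⟩
  rw [e.map_formula] at h₃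
  exact Formula.realize_iExs.1 h₃

theorem ExistentiallyClosedIn.trans {N M : Type*} [L.Structure N] [L.Structure M] {i : N ↪[L] M}
    {K : L.Substructure M} {K' : Set M} (hi : ∀ n, i n ∈ K)
    (h : ExistentiallyClosedIn i (K : Set M)) (h' : ExistentiallyClosedIn K.subtype K') :
    ExistentiallyClosedIn i K' := by
  intro n γ hγ x hx hr
  obtain ⟨y, hy⟩ := h' n (γ.relabel (Sum.map (fun m => ⟨i m, hi m⟩) id)) (hγ.relabel _) x hx (by
    rw [Formula.realize_relabel]
    convert hr using 1
    funext a
    cases a <;> rfl)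
  rw [Formula.realize_relabel, ← hγ.realize_formula_embedding K.subtype] at hy
  refine h n γ hγ (fun j => y j) (fun j => (y j).2) ?_
  convert hy using 1
  funext a
  cases a <;> rfl

/-- The converse of `ExistentiallyClosedIn.of_embedding`, by compactness. -/
theorem ExistentiallyClosedIn.exists_embedding [Countable L.Symbols] {N M : Type w}
    [L.Structure N] [Nonempty N] [L.Structure M] {i : N ↪[L] M} {K : L.Substructure M}
    (hi : ∀ n, i n ∈ K) (h : ExistentiallyClosedIn i (K : Set M)) :
    ∃ (E : Type w) (_ : L.Structure E) (e : N ↪ₑ[L] E) (g : K ↪[L] E),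
      ∀ n, g ⟨i n, hi n⟩ = e n := by
  classical
  have hK : Nonempty K := ⟨⟨i (Classical.arbitrary N), hi _⟩⟩
  obtain ⟨E, _, e, s, hs⟩ := exists_elementaryExtension_realizing (N := N) (α := K)
    {γ : L.Formula (N ⊕ K) | BoundedFormula.IsQF γ ∧ γ.Realize (Sum.elim i Subtype.val)} (by
      intro Γ₀ hΓ₀
      obtain ⟨χ, hχ, hχr⟩ := exists_qf_conjunction.{u, v, w} Γ₀ fun γ hγ => (hΓ₀ hγ).1
      obtain ⟨n, g, t, hgt⟩ := exists_fin_retraction χ.freeVarFinset.toRight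
      obtain ⟨y, hy⟩ := h _ (χ.relabel (Sum.map id g)) (hχ.relabel _) (fun j => t j)
        (fun j => (t j).2) (by
          rw [Formula.realize_relabel, realize_congr_of_eqOn (y := Sum.elim i Subtype.val)]
          · exact (hχr _).2 fun γ hγ => (hΓ₀ hγ).2
          · rintro (m | k) hmk
            · rfl
            · simp [hgt k (by simpa using hmk)])
      rw [Formula.realize_relabel, Sum.elim_comp_map] at hy
      exact ⟨y ∘ g, (hχr _).1 hy⟩)
  obtain ⟨g, hg⟩ := exists_embedding_of_qf s fun γ hγ hr => by
    have := hs (γ.relabel Sum.inr) ⟨hγ.relabel _, by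
      rw [Formula.realize_relabel]
      exact (hγ.realize_formula_embedding K.subtype (v := id)).2 hr⟩
    rwa [Formula.realize_relabel] at this
  refine ⟨E, _, e, g, fun n => ?_⟩
  rw [hg]
  have := hs (Term.equal (Term.var (Sum.inl n)) (Term.var (Sum.inr ⟨i n, hi n⟩)))
    ⟨(BoundedFormula.IsAtomic.equal _ _).isQF, by simp⟩
  simpa using this.symm

theorem realize_exs_relabel {M α β : Type*} [L.Structure M] {m : ℕ} (γ : L.Formula α)
    (g : α → β ⊕ Fin m) (v : β → M) :
    (BoundedFormula.relabel g γ).exs.Realize v ↔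
      ∃ xs : Fin m → M, γ.Realize (Sum.elim v xs ∘ g) := by
  simp only [BoundedFormula.realize_exs, BoundedFormula.realize_relabel]
  refine exists_congr fun xs => ?_
  exact iff_of_eq (congrArg (BoundedFormula.Realize γ (Sum.elim v xs ∘ g)) (Subsingleton.elim _ _))

theorem ExistentiallyClosedIn.of_existential_absolute {N M : Type*} [L.Structure N] [Nonempty N]
    [L.Structure M] {i : N ↪[L] M}
    (h : ∀ (n : ℕ) (φ : L.Formula (Fin n)), φ.IsExistential →
      ∀ b : Fin n → N, φ.Realize (i ∘ b) → φ.Realize b) (K : Set M) :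
    ExistentiallyClosedIn i K := by
  classical
  intro m γ hγ x _ hr
  obtain ⟨n, g, t, hgt⟩ := exists_fin_retraction γ.freeVarFinset.toLeft
  have key := h _ (BoundedFormula.relabel (Sum.map g id) γ).exs (hγ.relabel _).isExistential.exs t
  simp only [realize_exs_relabel] at key
  have hx : γ.Realize (Sum.elim (i ∘ t) x ∘ Sum.map g id) := by
    refine (realize_congr_of_eqOn γ (x := Sum.elim i x) ?_).1 hr
    rintro (a | a) ha
    · simp [hgt a (by simpa using ha)]
    · rfl
  obtain ⟨y, hy⟩ := key ⟨x, hx⟩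
  refine ⟨y, (realize_congr_of_eqOn γ ?_).1 hy⟩
  rintro (a | a) ha
  · simp [hgt a (by simpa using ha)]
  · rfl

/-! ### Model completeness -/

variable {T : L.Theory}

/-- **Robinson's test**: if existential formulas are absolute between models of `T`, then all
embeddings between models of `T` are elementary. -/
theorem elementaryEmbedding_of_existential_absolute [Countable L.Symbols]
    (habs : ∀ (A B : Theory.ModelType.{u, v, w} T) (i : A ↪[L] B) (n : ℕ) (φ : L.Formula (Fin n)),
      φ.IsExistential → ∀ b : Fin n → A, φ.Realize (i ∘ b) → φ.Realize b)
    {α : Type*} {n : ℕ} (φ : L.BoundedFormula α n) :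
    ∀ (A B : Theory.ModelType.{u, v, w} T) (i : A ↪[L] B) (x : α → A) (xs : Fin n → A),
      φ.Realize (i ∘ x) (i ∘ xs) ↔ φ.Realize x xs := by
  induction φ with
  | falsum => exact fun _ _ _ _ _ => Iff.rfl
  | equal t₁ t₂ =>
    exact fun _ _ i _ _ => (BoundedFormula.IsAtomic.equal t₁ t₂).isQF.realize_embedding i
  | rel R ts => exact fun _ _ i _ _ => (BoundedFormula.IsAtomic.rel R ts).isQF.realize_embedding i
  | imp _ _ ih₁ ih₂ =>
    intro A B i x xs
    rw [BoundedFormula.realize_imp, BoundedFormula.realize_imp, ih₁, ih₂]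
  | @all n φ ih =>
    intro A B i x xs
    simp only [BoundedFormula.realize_all]
    refine ⟨fun h a => ?_, fun h b => ?_⟩
    · have := h (i a)
      rwa [← Fin.comp_snoc, ih] at this
    · -- `A` is existentially closed in `B`, so `B` embeds over `A` in some `E` elementary over `A`.
      obtain ⟨E, _, e, g, hg⟩ := (ExistentiallyClosedIn.of_existential_absolute (habs A B i)
        (K := ((⊤ : L.Substructure B) : Set B))).exists_embedding fun _ => Substructure.mem_top _
      have hE : E ⊨ T := (e.theory_model_iff T).1 inferInstance
      have hne : Nonempty E := ⟨e (Classical.arbitrary A)⟩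
      let g' : B ↪[L] E := g.comp Substructure.topEquiv.symm.toEmbedding
      have hg' : ∀ a, g' (i a) = e a := hg
      have h₁ : φ.all.Realize (e ∘ x) (e ∘ xs) := (e.map_boundedFormula φ.all x xs).2 h
      have h₂ := BoundedFormula.realize_all.1 h₁ (g' b)
      rw [show e ∘ x = g' ∘ (i ∘ x) from funext fun a => (hg' _).symm,
        show e ∘ xs = g' ∘ (i ∘ xs) from funext fun a => (hg' _).symm, ← Fin.comp_snoc] at h₂
      exact (ih B (Theory.ModelType.of T E) g' _ _).1 h₂

namespace StrongShoenfieldProperty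

variable (hT : StrongShoenfieldProperty.{u, v, w} T)
include hT

theorem existential_absolute_embedding (A B : Theory.ModelType.{u, v, w} T) (i : A ↪[L] B) (n : ℕ)
    (φ : L.Formula (Fin n)) (hφ : φ.IsExistential) (b : Fin n → A) (h : φ.Realize (i ∘ b)) :
    φ.Realize b := by
  have hN : i.toHom.range ⊨ T := StrongHomClass.theory_model i.equivRange
  have hne : Nonempty i.toHom.range := ⟨i.equivRange (Classical.arbitrary A)⟩
  have := (hT.existential_absolute B i.toHom.range hne hN n φ hφ (i.equivRange ∘ b)).1 h
  exact (StrongHomClass.realize_formula i.equivRange φ).1 this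

theorem realize_embedding [Countable L.Symbols] {α : Type*} (φ : L.Formula α)
    {A B : Theory.ModelType.{u, v, w} T} (i : A ↪[L] B) (x : α → A) :
    φ.Realize (i ∘ x) ↔ φ.Realize x := by
  have := elementaryEmbedding_of_existential_absolute hT.existential_absolute_embedding φ A B i x
    default
  rwa [Unique.eq_default (i ∘ default)] at this

theorem sameType_embedding [Countable L.Symbols] {α : Type*}
    {A B : Theory.ModelType.{u, v, w} T} (i : A ↪[L] B) (x : α → A) : SameType L x (i ∘ x) :=
  fun φ => (hT.realize_embedding φ i x).symm

/-- Two models of `T` with a common nonempty substructure `N` have a common submodel over `N`. -/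
theorem exists_common_submodel {N : Type w} [L.Structure N] [Nonempty N]
    {A B : Theory.ModelType.{u, v, w} T} (i : N ↪[L] A) (j : N ↪[L] B) :
    ∃ (C : Theory.ModelType.{u, v, w} T) (p : C ↪[L] A) (q : C ↪[L] B) (k : N → C),
      (∀ n, p (k n) = i n) ∧ ∀ n, q (k n) = j n := by
  obtain ⟨A', B', hA, hB, f, hA', hB', hf⟩ := hT.extend_iso A B i.toHom.range j.toHom.range
    (i.equivRange.toEquiv.nonempty_congr.1 inferInstance)
    (j.equivRange.toEquiv.nonempty_congr.1 inferInstance) (j.equivRange.comp i.equivRange.symm)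
  have hne : Nonempty A' := ⟨Substructure.inclusion hA (i.equivRange (Classical.arbitrary N))⟩
  refine ⟨Theory.ModelType.of T A', A'.subtype, B'.subtype.comp f.toEmbedding,
    fun n => Substructure.inclusion hA (i.equivRange n), fun n => rfl, fun n => ?_⟩
  exact (congrArg Subtype.val (hf (i.equivRange n))).trans (by simp)

/-- Embeddings of a common substructure in two models of `T` give it the same types: a form of
quantifier elimination. -/
theorem sameType_of_embeddings [Countable L.Symbols] {N : Type w} [L.Structure N] [Nonempty N]
    {A B : Theory.ModelType.{u, v, w} T} (i : N ↪[L] A) (j : N ↪[L] B) :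
    SameType L (i : N → A) (j : N → B) := by
  obtain ⟨C, p, q, k, hp, hq⟩ := hT.exists_common_submodel i j
  have h₁ := hT.sameType_embedding p k
  have h₂ := hT.sameType_embedding q k
  rw [show p ∘ k = i from funext hp] at h₁
  rw [show q ∘ k = j from funext hq] at h₂
  exact h₁.symm.trans h₂

end StrongShoenfieldProperty

/-! ### From the van den Dries property to the strong Shoenfield property -/

namespace VanDenDriesProperty

variable (hT : VanDenDriesProperty.{u, v, w} T)
include hT

theorem extend_iso (M₁ M₂ : Theory.ModelType.{u, v, w} T) (N₁ : L.Substructure M₁)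
    (N₂ : L.Substructure M₂) (hN₁ : Nonempty N₁) (f : N₁ ≃[L] N₂) :
    ∃ (N₁' : L.Substructure M₁) (N₂' : L.Substructure M₂) (h₁ : N₁ ≤ N₁') (h₂ : N₂ ≤ N₂')
      (f' : N₁' ≃[L] N₂'), N₁' ⊨ T ∧ N₂' ⊨ T ∧
        ∀ x : N₁, f' (Substructure.inclusion h₁ x) = Substructure.inclusion h₂ (f x) := by
  obtain ⟨C, i, hC⟩ := hT.exists_closure N₁ ⟨M₁, ⟨N₁.subtype⟩⟩
  obtain ⟨p, hp⟩ := hC M₁ N₁.subtype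
  obtain ⟨q, hq⟩ := hC M₂ (N₂.subtype.comp f.toEmbedding)
  have h₁ : N₁ ≤ p.toHom.range := fun x hx => ⟨i ⟨x, hx⟩, hp ⟨x, hx⟩⟩
  have h₂ : N₂ ≤ q.toHom.range := fun x hx => ⟨i (f.symm ⟨x, hx⟩), by
    change q (i (f.symm ⟨x, hx⟩)) = x
    simp [hq]⟩
  refine ⟨p.toHom.range, q.toHom.range, h₁, h₂, q.equivRange.comp p.equivRange.symm,
    StrongHomClass.theory_model p.equivRange, StrongHomClass.theory_model q.equivRange, ?_⟩
  intro x
  have hx : p.equivRange.symm (Substructure.inclusion h₁ x) = i x := by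
    apply p.equivRange.injective
    rw [p.equivRange.apply_symm_apply]
    exact Subtype.ext (hp x).symm
  refine Subtype.ext ?_
  change q (p.equivRange.symm (Substructure.inclusion h₁ x)) = f x
  rw [hx, hq]
  rfl

/-- By Zorn's lemma there is a maximal `K` between `N` and `M` in which `N` is existentially
closed. Both parts of the van den Dries property enlarge such a `K` unless it is `M`. -/
theorem existentiallyClosedIn_top [Countable L.Symbols] (M : Theory.ModelType.{u, v, w} T)
    (N : L.Substructure M) (hne : Nonempty N) (hN : N ⊨ T) :
    ExistentiallyClosedIn N.subtype ((⊤ : L.Substructure M) : Set M) := by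
  let S : Set (L.Substructure M) := {K | N ≤ K ∧ ExistentiallyClosedIn N.subtype (K : Set M)}
  have hNS : N ∈ S := ⟨le_rfl, .of_embedding N.subtype (Embedding.refl L N)
    (ElementaryEmbedding.refl L N) id (fun _ => rfl) (fun _ => rfl) fun x hx => ⟨⟨x, hx⟩, rfl⟩⟩
  obtain ⟨K, -, ⟨hNK, hK⟩, hmax⟩ := zorn_le_nonempty₀ S (by
    intro c hcS hc K₀ hK₀
    refine ⟨sSup c, ⟨(hcS hK₀).1.trans (le_sSup hK₀), ?_⟩, fun K hK => le_sSup hK⟩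
    intro n γ hγ x hx hr
    have hdir : DirectedOn (· ≤ ·) c := hc.directedOn
    -- The finitely many `x j` lie in a single member of the chain.
    have key : ∀ F : Finset (Fin n), ∃ K ∈ c, ∀ j ∈ F, x j ∈ K := by
      classical
      intro F
      induction F using Finset.induction_on with
      | empty => exact ⟨K₀, hK₀, by simp⟩
      | insert j F _ ih =>
        obtain ⟨K₁, hK₁, h₁⟩ := ih
        obtain ⟨K₂, hK₂, h₂⟩ := (Substructure.mem_sSup_of_directedOn ⟨K₀, hK₀⟩ hdir).1 (hx j)
        obtain ⟨K₃, hK₃, h₁₃, h₂₃⟩ := hdir K₁ hK₁ K₂ hK₂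
        refine ⟨K₃, hK₃, fun k hk => ?_⟩
        rcases Finset.mem_insert.1 hk with rfl | hk
        · exact h₂₃ h₂
        · exact h₁₃ (h₁ k hk)
    obtain ⟨K, hKc, hxK⟩ := key Finset.univ
    exact (hcS hKc).2 n γ hγ x (fun j => hxK j (Finset.mem_univ j)) hr) N hNS
  have hKne : Nonempty K := hne.map (Substructure.inclusion hNK)
  -- `K` is a model of `T`: it contains the image of its `T`-closure in `M`.
  have hKT : K ⊨ T := by
    obtain ⟨E, _, e, g, hg⟩ := hK.exists_embedding fun n => hNK n.2
    have hE : E ⊨ T := (e.theory_model_iff T).1 hN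
    have hEne : Nonempty E := hne.map e
    obtain ⟨C, k, hC⟩ := hT.exists_closure K ⟨M, ⟨K.subtype⟩⟩
    obtain ⟨p, hp⟩ := hC M K.subtype
    obtain ⟨q, hq⟩ := hC (Theory.ModelType.of T E) g
    have hle : K ≤ p.toHom.range := fun x hx => ⟨k ⟨x, hx⟩, hp ⟨x, hx⟩⟩
    have hEC : ExistentiallyClosedIn N.subtype (p.toHom.range : Set M) :=
      .of_embedding p q e (fun n => k (Substructure.inclusion hNK n)) (fun n => hp _)
        (fun n => (hq _).trans (hg n)) fun x hx => hx
    have hKp : K = p.toHom.range := le_antisymm hle (hmax ⟨hNK.trans hle, hEC⟩ hle)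
    rw [hKp]
    exact StrongHomClass.theory_model p.equivRange
  -- `K` is all of `M`: otherwise some `K + a` embeds over `K` in an elementary extension of `K`.
  have hKtop : K = ⊤ := by
    by_contra hKtop
    obtain ⟨a, ha, E, _, e, g, hg⟩ := hT.exists_adjoin_embedding M K hKne hKT hKtop
    have hEC : ExistentiallyClosedIn K.subtype (adjoin K a : Set M) :=
      .of_embedding (adjoin K a).subtype g e (Substructure.inclusion (le_adjoin K a))
        (fun _ => rfl) hg fun x hx => ⟨⟨x, hx⟩, rfl⟩
    have hle := hmax ⟨hNK.trans (le_adjoin K a), hK.trans (fun n => hNK n.2) hEC⟩ (le_adjoin K a)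
    exact ha (hle (Substructure.subset_closure (Set.mem_insert a _)))
  rwa [← hKtop]

theorem strongShoenfieldProperty [Countable L.Symbols] : StrongShoenfieldProperty.{u, v, w} T where
  extend_iso M₁ M₂ N₁ N₂ hN₁ _ f := hT.extend_iso M₁ M₂ N₁ N₂ hN₁ f
  existential_absolute M N hne hN n φ hφ b := by
    refine ⟨fun h => ?_, fun h => hφ.realize_formula_embedding N.subtype h⟩
    obtain ⟨E, _, e, g, hg⟩ :=
      (hT.existentiallyClosedIn_top M N hne hN).exists_embedding fun _ => Substructure.mem_top _
    have h₁ := hφ.realize_formula_embedding (g.comp Substructure.topEquiv.symm.toEmbedding) h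
    rw [← e.map_formula]
    convert h₁ using 1
    exact funext fun i => (hg (b i)).symm

end VanDenDriesProperty

end QETests

namespace QETests

open Set

variable {L : FirstOrder.Language.{u, v}}

/-! ### Isolated types -/

/-- The family `a` extended by one more element `x`. -/
def extendBy {ι M : Type*} (a : ι → M) (x : M) : ι ⊕ Unit → M :=
  Sum.elim a fun _ => x

section Isolated

variable {ι κ M P : Type*}

theorem extendBy_comp (a : ι → M) (x : M) (f : κ → ι) :
    extendBy a x ∘ Sum.map f id = extendBy (a ∘ f) x := by
  funext j
  cases j <;> rfl

theorem comp_extendBy (a : ι → M) (x : M) (e : M → P) :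
    e ∘ extendBy a x = extendBy (e ∘ a) (e x) := by
  funext j
  cases j <;> rfl

variable [L.Structure M] [L.Structure P]

theorem realize_iExs_unit {φ : L.Formula (ι ⊕ Unit)} {a : ι → M} :
    (φ.iExs Unit).Realize a ↔ ∃ x, φ.Realize (extendBy a x) := by
  rw [Formula.realize_iExs]
  exact ⟨fun ⟨s, hs⟩ => ⟨s (), hs⟩, fun ⟨x, hx⟩ => ⟨fun _ => x, hx⟩⟩

theorem SameType.exists_realize_extendBy {a : ι → M} {b : ι → P} (h : SameType L a b)
    (φ : L.Formula (ι ⊕ Unit)) :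
    (∃ x, φ.Realize (extendBy a x)) ↔ ∃ y, φ.Realize (extendBy b y) := by
  rw [← realize_iExs_unit, ← realize_iExs_unit]
  exact h _

theorem SameType.forall_realize_imp {a : ι → M} {b : ι → P} (h : SameType L a b)
    {φ ψ : L.Formula (ι ⊕ Unit)}
    (hφψ : ∀ x, φ.Realize (extendBy a x) → ψ.Realize (extendBy a x)) (y : P)
    (hy : φ.Realize (extendBy b y)) : ψ.Realize (extendBy b y) := by
  by_contra hψ
  obtain ⟨x, hx⟩ := (h.exists_realize_extendBy (φ ⊓ ∼ψ)).2
    ⟨y, by rw [Formula.realize_inf, Formula.realize_not]; exact ⟨hy, hψ⟩⟩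
  rw [Formula.realize_inf, Formula.realize_not] at hx
  exact hx.2 (hφψ x hx.1)

variable (L) in
/-- The type of `x` over the family `a` is isolated: some formula `φ` over `a` satisfied by `x`
implies all others. -/
def IsolatedOver (a : ι → M) (x : M) : Prop :=
  ∃ φ : L.Formula (ι ⊕ Unit), φ.Realize (extendBy a x) ∧
    ∀ ψ : L.Formula (ι ⊕ Unit), ψ.Realize (extendBy a x) →
      ∀ y, φ.Realize (extendBy a y) → ψ.Realize (extendBy a y)

theorem IsolatedOver.reindex {a : ι → M} {b : κ → M} {x : M} (h : IsolatedOver L a x)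
    (f : κ → ι) (g : ι → κ) (hf : b = a ∘ f) (hg : a = b ∘ g) : IsolatedOver L b x := by
  obtain ⟨φ, hφ, h⟩ := h
  refine ⟨φ.relabel (Sum.map g id), ?_, fun ψ hψ y hy => ?_⟩
  · rwa [Formula.realize_relabel, extendBy_comp, ← hg]
  · have := h (ψ.relabel (Sum.map f id))
    simp only [Formula.realize_relabel, extendBy_comp, ← hf, ← hg] at this hy
    exact this hψ y hy

theorem IsolatedOver.of_mem_range {a : ι → M} {x : M} (hx : x ∈ range a) : IsolatedOver L a x := by
  obtain ⟨i, rfl⟩ := hx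
  refine ⟨Term.equal (Term.var (Sum.inr ())) (Term.var (Sum.inl i)), by simp [extendBy],
    fun ψ hψ y hy => ?_⟩
  have : y = a i := by simpa [extendBy] using hy
  rwa [this]

theorem IsolatedOver.map_elementary {a : ι → M} {x : M} (h : IsolatedOver L a x)
    (e : M ↪ₑ[L] P) : IsolatedOver L (e ∘ a) (e x) := by
  obtain ⟨φ, hφ, h⟩ := h
  refine ⟨φ, ?_, fun ψ hψ => ?_⟩
  · rwa [← comp_extendBy, e.map_formula]
  · rw [← comp_extendBy, e.map_formula] at hψ
    exact (e.sameType a).forall_realize_imp (h ψ hψ)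

/-- A partial elementary map extends to any point whose type over its domain is isolated. -/
theorem SameType.exists_extendBy {a : ι → M} {b : ι → P} (h : SameType L a b) {x : M}
    (hx : IsolatedOver L a x) : ∃ y, SameType L (extendBy a x) (extendBy b y) := by
  obtain ⟨φ, hφ, hiso⟩ := hx
  obtain ⟨y, hy⟩ := (h.exists_realize_extendBy φ).1 ⟨x, hφ⟩
  have key : ∀ ψ : L.Formula (ι ⊕ Unit), ψ.Realize (extendBy a x) → ψ.Realize (extendBy b y) :=
    fun ψ hψ => h.forall_realize_imp (hiso ψ hψ) y hy
  refine ⟨y, fun ψ => ⟨key ψ, fun hψ => ?_⟩⟩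
  by_contra hne
  have := key (∼ψ) (by rwa [Formula.realize_not])
  rw [Formula.realize_not] at this
  exact this hψ

/-- The Tarski–Vaught criterion for the range of a family. -/
theorem meetsDefinable_range {s : ι → M} (h : ∀ ψ : L.Formula (ι ⊕ Unit),
    (∃ x, ψ.Realize (extendBy s x)) → ∃ i, ψ.Realize (extendBy s (s i))) :
    L.MeetsDefinable (range s) := by
  rintro D ⟨x, hx⟩ hD
  obtain ⟨φ, hφ⟩ := definable_iff_exists_formula_sum.1 hD
  have hφ' : ∀ v : Fin 1 → M, v 0 ∈ D ↔ φ.Realize (Sum.elim Subtype.val v) := fun v =>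
    iff_of_eq (congrFun hφ v)
  choose g hg using fun y : range s => y.2
  have hcomp : ∀ y, extendBy s y ∘ Sum.map g (fun _ : Fin 1 => ()) =
      Sum.elim Subtype.val fun _ => y := by
    intro y
    funext j
    rcases j with j | j
    · exact hg j
    · rfl
  obtain ⟨i, hi⟩ := h (φ.relabel (Sum.map g fun _ => ())) ⟨x, by
    rw [Formula.realize_relabel, hcomp]
    exact (hφ' fun _ => x).1 hx⟩
  rw [Formula.realize_relabel, hcomp] at hi
  exact ⟨s i, (hφ' fun _ => s i).2 hi, i, rfl⟩

end Isolated

/-! ### Omitting non-isolated types -/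

theorem exists_bound (F : Finset ℕ) : ∃ k, ∀ i ∈ F, i < k :=
  ⟨F.sup id + 1, fun _ hi => Nat.lt_succ_of_le (Finset.le_sup (f := id) hi)⟩

/-- The projection to the coordinate `j` of the set defined by a formula in infinitely many
variables is definable, since only finitely many variables occur. -/
theorem exists_projection_formula (θ : L.Formula (ℕ ⊕ ℕ)) (j : ℕ) {M : Type*} [L.Structure M]
    (b : ℕ → M) : ∃ θ' : L.Formula (ℕ ⊕ Unit), ∀ y : M,
      θ'.Realize (extendBy b y) ↔ ∃ s : ℕ → M, s j = y ∧ θ.Realize (Sum.elim b s) := by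
  classical
  obtain ⟨k, hk⟩ := exists_bound θ.freeVarFinset.toRight
  let ρ : ℕ → (ℕ ⊕ Unit) ⊕ Fin k := fun i =>
    if h : i ≠ j ∧ i < k then Sum.inr ⟨i, h.2⟩ else Sum.inl (Sum.inr ())
  refine ⟨(θ.relabel (Sum.elim (fun n => Sum.inl (Sum.inl n)) ρ)).iExs (Fin k), fun y => ?_⟩
  rw [Formula.realize_iExs]
  constructor
  · rintro ⟨t, ht⟩
    rw [Formula.realize_relabel] at ht
    refine ⟨Sum.elim (extendBy b y) t ∘ ρ, by simp [ρ, extendBy], ?_⟩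
    convert ht using 1
    funext a
    cases a <;> rfl
  · rintro ⟨s, hs, h⟩
    refine ⟨fun i => s i, ?_⟩
    rw [Formula.realize_relabel]
    refine (realize_congr_of_eqOn θ ?_).1 h
    rintro (n | i) hi
    · rfl
    · have hik : i < k := hk i (by simpa using hi)
      by_cases hij : i = j
      · simp [ρ, hij, extendBy, hs]
      · simp [ρ, hij, hik]

/-- An omitting types theorem: for a sequence `b` in a countable structure `M` there is a structure
`S` elementarily equivalent to `M` over `b` in which no element has the type over `b` of an element
of `M` of non-isolated type. It is obtained as an elementary substructure of an extension of `M`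
from a generic filter for the forcing notion whose conditions are the satisfiable formulas about a
sequence of elements, which is to enumerate `S`. -/
theorem exists_elementary_omitting [Countable L.Symbols] {M : Type w} [L.Structure M] [Nonempty M]
    [Countable M] (b : ℕ → M) :
    ∃ (E : Type w) (_ : L.Structure E) (e : M ↪ₑ[L] E) (S : L.ElementarySubstructure E),
      (∀ n, e (b n) ∈ S) ∧ ∀ y ∈ S, ∀ x : M, ¬IsolatedOver L b x →
        ¬SameType L (extendBy b x) (extendBy (e ∘ b) y) := by
  classical
  let Cond := {θ : L.Formula (ℕ ⊕ ℕ) // ∃ s : ℕ → M, θ.Realize (Sum.elim b s)}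
  let _ : Preorder Cond := Preorder.lift fun θ : Cond =>
    OrderDual.toDual {s : ℕ → M | θ.1.Realize (Sum.elim b s)}
  have hle : ∀ {θ θ' : Cond}, θ ≤ θ' →
      ∀ {s : ℕ → M}, θ'.1.Realize (Sum.elim b s) → θ.1.Realize (Sum.elim b s) :=
    fun {θ θ'} h {s} hs => by
      have h' : {s | θ'.1.Realize (Sum.elim b s)} ⊆ {s | θ.1.Realize (Sum.elim b s)} := h
      exact h' hs
  have hstr : ∀ (θ : Cond) (γ : L.Formula (ℕ ⊕ ℕ)), (∃ s : ℕ → M, θ.1.Realize (Sum.elim b s) ∧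
      γ.Realize (Sum.elim b s)) → ∃ θ' : Cond, θ ≤ θ' ∧
        ∀ s : ℕ → M, θ'.1.Realize (Sum.elim b s) → γ.Realize (Sum.elim b s) := by
    rintro θ γ ⟨s, hs, hs'⟩
    refine ⟨⟨θ.1 ⊓ γ, s, Formula.realize_inf.2 ⟨hs, hs'⟩⟩, fun t ht => ?_, fun t ht => ?_⟩
    · exact (Formula.realize_inf.1 ht).1
    · exact (Formula.realize_inf.1 ht).2
  -- Generic filters contain witnesses for existential statements …
  let inst (ψ : L.Formula ((ℕ ⊕ ℕ) ⊕ Unit)) (j : ℕ) : L.Formula (ℕ ⊕ ℕ) :=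
    ψ.relabel (Sum.elim id fun _ => Sum.inr j)
  let H (ψ : L.Formula ((ℕ ⊕ ℕ) ⊕ Unit)) : Order.Cofinal Cond :=
    ⟨{θ | (∀ s, θ.1.Realize (Sum.elim b s) → Formula.Realize (∼(ψ.iExs Unit)) (Sum.elim b s)) ∨
      ∃ j, ∀ s, θ.1.Realize (Sum.elim b s) → (inst ψ j).Realize (Sum.elim b s)}, by
      intro θ
      obtain ⟨s, hs⟩ := θ.2
      by_cases hx : ∃ x, ψ.Realize (extendBy (Sum.elim b s) x)
      · obtain ⟨x, hx⟩ := hx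
        -- Choose a variable `j` that occurs neither in the condition nor in `ψ`.
        obtain ⟨j, hj⟩ := exists_bound
          (θ.1.freeVarFinset.toRight ∪ ψ.freeVarFinset.toLeft.toRight)
        obtain ⟨θ', hθ, h⟩ := hstr θ (inst ψ j) ⟨Function.update s j x, by
          refine (realize_congr_of_eqOn θ.1 ?_).1 hs
          rintro (n | i) hi
          · rfl
          · have : i < j := hj i (Finset.mem_union_left _ (by simpa using hi))
            simp [this.ne], by
          rw [Formula.realize_relabel]
          refine (realize_congr_of_eqOn ψ ?_).1 hx
          rintro ((n | i) | u) hi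
          · rfl
          · have : i < j := hj i (Finset.mem_union_right _ (by simpa using hi))
            exact (Function.update_of_ne this.ne x s).symm
          · exact (Function.update_self j x s).symm⟩
        exact ⟨θ', Or.inr ⟨j, h⟩, hθ⟩
      · obtain ⟨θ', hθ, h⟩ := hstr θ (∼(ψ.iExs Unit)) ⟨s, hs, by
          rwa [Formula.realize_not, realize_iExs_unit]⟩
        exact ⟨θ', Or.inl h, hθ⟩⟩
  -- … and keep the new elements from realizing non-isolated types of `M`.
  let sub (χ : L.Formula (ℕ ⊕ Unit)) (j : ℕ) : L.Formula (ℕ ⊕ ℕ) :=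
    χ.relabel (Sum.map id fun _ => j)
  have hsub : ∀ (χ : L.Formula (ℕ ⊕ Unit)) (j : ℕ) (s : ℕ → M),
      (sub χ j).Realize (Sum.elim b s) ↔ χ.Realize (extendBy b (s j)) := by
    intro χ j s
    rw [Formula.realize_relabel, Sum.elim_comp_map]
    rfl
  let O (p : {x : M // ¬IsolatedOver L b x} × ℕ) : Order.Cofinal Cond :=
    ⟨{θ | ∃ χ : L.Formula (ℕ ⊕ Unit), χ.Realize (extendBy b p.1.1) ∧
      ∀ s, θ.1.Realize (Sum.elim b s) → Formula.Realize (∼(sub χ p.2)) (Sum.elim b s)}, by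
      intro θ
      obtain ⟨⟨x, hx⟩, j⟩ := p
      obtain ⟨θj, hθj⟩ := exists_projection_formula θ.1 j b
      by_cases hxθ : θj.Realize (extendBy b x)
      · have : ∃ ψ : L.Formula (ℕ ⊕ Unit), ψ.Realize (extendBy b x) ∧
            ∃ y, θj.Realize (extendBy b y) ∧ ¬ψ.Realize (extendBy b y) := by
          by_contra! hcon
          exact hx ⟨θj, hxθ, hcon⟩
        obtain ⟨ψ, hψ, y, hy, hψy⟩ := this
        obtain ⟨s, rfl, hs⟩ := (hθj y).1 hy
        obtain ⟨θ', hθ, h⟩ := hstr θ (∼(sub ψ j))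
          ⟨s, hs, by rwa [Formula.realize_not, hsub]⟩
        exact ⟨θ', ⟨ψ, hψ, h⟩, hθ⟩
      · refine ⟨θ, ⟨∼θj, by rwa [Formula.realize_not], fun s hs => ?_⟩, le_rfl⟩
        rw [Formula.realize_not, hsub, Formula.realize_not, not_not]
        exact (hθj _).2 ⟨s, rfl, hs⟩⟩
  let _ : Encodable (L.Formula ((ℕ ⊕ ℕ) ⊕ Unit) ⊕ ({x : M // ¬IsolatedOver L b x} × ℕ)) :=
    Encodable.ofCountable _
  let G := Order.idealOfCofinals (⟨⊤, fun _ => Classical.arbitrary M, by simp [Formula.Realize]⟩ :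
    Cond) (Sum.elim H O)
  have hG := Order.cofinal_meets_idealOfCofinals (⟨⊤, fun _ => Classical.arbitrary M,
    by simp [Formula.Realize]⟩ : Cond) (Sum.elim H O)
  have hfin : ∀ Γ₀ : Finset (L.Formula (M ⊕ ℕ)), (∀ γ ∈ Γ₀, ∃ θ ∈ G, ∀ s : ℕ → M,
      θ.1.Realize (Sum.elim b s) → γ.Realize (Sum.elim id s)) → ∃ θ ∈ G, ∀ s : ℕ → M,
        θ.1.Realize (Sum.elim b s) → ∀ γ ∈ Γ₀, γ.Realize (Sum.elim id s) := by
    intro Γ₀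
    induction Γ₀ using Finset.induction_on with
    | empty => exact fun _ => ⟨_, Order.mem_idealOfCofinals _ _, by simp⟩
    | insert γ Γ₀ _ ih =>
      intro h
      rw [Finset.forall_mem_insert] at h
      obtain ⟨⟨θ₁, h₁, h₁'⟩, h⟩ := h
      obtain ⟨θ₂, h₂, h₂'⟩ := ih h
      obtain ⟨θ, hθ, hθ₁, hθ₂⟩ := G.directed θ₁ h₁ θ₂ h₂
      exact ⟨θ, hθ, fun s hs => (Finset.forall_mem_insert _ _ _).2
        ⟨h₁' s (hle hθ₁ hs), h₂' s (hle hθ₂ hs)⟩⟩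
  obtain ⟨E, _, e, s, hs⟩ := exists_elementaryExtension_realizing (L := L) (N := M) (α := ℕ)
    {γ | ∃ θ ∈ G, ∀ s : ℕ → M, θ.1.Realize (Sum.elim b s) → γ.Realize (Sum.elim id s)} fun Γ₀ h => by
      obtain ⟨θ, -, hθ⟩ := hfin Γ₀ h
      obtain ⟨s, hs⟩ := θ.2
      exact ⟨s, hθ s hs⟩
  have hgen : ∀ γ : L.Formula (ℕ ⊕ ℕ), (∃ θ ∈ G, ∀ s : ℕ → M, θ.1.Realize (Sum.elim b s) →
      γ.Realize (Sum.elim b s)) → γ.Realize (Sum.elim (e ∘ b) s) := by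
    rintro γ ⟨θ, hθ, h⟩
    have := hs (γ.relabel (Sum.map b id)) ⟨θ, hθ, fun s hs => by
      rw [Formula.realize_relabel, Sum.elim_comp_map]
      exact h s hs⟩
    rwa [Formula.realize_relabel, Sum.elim_comp_map] at this
  have hHenkin : ∀ ψ : L.Formula ((ℕ ⊕ ℕ) ⊕ Unit),
      (∃ x, ψ.Realize (extendBy (Sum.elim (e ∘ b) s) x)) →
        ∃ j, ψ.Realize (extendBy (Sum.elim (e ∘ b) s) (s j)) := by
    intro ψ hψ
    obtain ⟨θ, h | ⟨j, h⟩, hθ⟩ := hG (Sum.inl ψ)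
    · have := hgen _ ⟨θ, hθ, h⟩
      rw [Formula.realize_not, realize_iExs_unit] at this
      exact absurd hψ this
    · refine ⟨j, ?_⟩
      have := hgen _ ⟨θ, hθ, h⟩
      rw [Formula.realize_relabel] at this
      convert this using 1
      funext a
      cases a <;> rfl
  have hMD : L.MeetsDefinable (range s) := meetsDefinable_range fun ψ ⟨x, hx⟩ => by
    obtain ⟨j, hj⟩ := hHenkin (ψ.relabel (Sum.map Sum.inr id)) ⟨x, by
      rwa [Formula.realize_relabel, extendBy_comp, Sum.elim_comp_inr]⟩
    rw [Formula.realize_relabel, extendBy_comp, Sum.elim_comp_inr] at hj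
    exact ⟨j, hj⟩
  have hmem : ∀ y, y ∈ hMD.toElementarySubstructure ↔ y ∈ range s := fun y =>
    Set.ext_iff.1 hMD.closure_eq_self y
  refine ⟨E, _, e, hMD.toElementarySubstructure, fun n => (hmem _).2 ?_, fun y hy x hx hxy => ?_⟩
  · obtain ⟨j, hj⟩ := hHenkin (Term.equal (Term.var (Sum.inr ())) (Term.var (Sum.inl (Sum.inl n))))
      ⟨e (b n), by simp [extendBy]⟩
    exact ⟨j, by simpa [extendBy] using hj⟩
  · obtain ⟨j, rfl⟩ := (hmem y).1 hy
    obtain ⟨θ, ⟨χ, hχ, h⟩, hθ⟩ := hG (Sum.inr (⟨x, hx⟩, j))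
    have := hgen _ ⟨θ, hθ, h⟩
    rw [Formula.realize_not, Formula.realize_relabel, Sum.elim_comp_map] at this
    exact this ((hxy χ).1 hχ)

end QETests

namespace QETests

open Set

variable {L : FirstOrder.Language.{u, v}} {T : L.Theory}

/-! ### Density of isolated types -/

theorem exists_countable_elementarySubstructure [Countable L.Symbols] {M : Type w} [L.Structure M]
    [Nonempty M] {s : Set M} (hs : s.Countable) :
    ∃ S : L.ElementarySubstructure M, s ⊆ S ∧ Countable S := by
  have : Countable (Σ n, (L.sum L.skolem₁).Functions n) := by
    rw [← Cardinal.mk_le_aleph0_iff]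
    exact card_functions_sum_skolem₁_le.trans
      (max_le le_rfl (Cardinal.mk_le_aleph0_iff.2 ‹Countable L.Symbols›))
  exact ⟨(Substructure.closure (L.sum L.skolem₁) s).elementarySkolem₁Reduct,
    Substructure.subset_closure (L := L.sum L.skolem₁), hs.substructure_closure (L.sum L.skolem₁)⟩

theorem sameType_extendBy {ι M P : Type*} [L.Structure M] [L.Structure P] (e : M ↪ₑ[L] P)
    (a : ι → M) (x : M) : SameType L (extendBy a x) (extendBy (e ∘ a) (e x)) := by
  have := e.sameType (extendBy a x)
  rwa [comp_extendBy] at this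

namespace StrongShoenfieldProperty

/-- Over countably many parameters in a model of `T`, every satisfiable formula is satisfied by an
element of isolated type. Otherwise, omit the types realizing `φ` in a countable model `A`: this
gives a model `B` such that no submodel of `A` is isomorphic to a submodel of `B` over the
parameters, against the Shoenfield property. -/
theorem exists_isolatedOver_sequence [Countable L.Symbols]
    (hT : StrongShoenfieldProperty.{u, v, w} T) (M : Theory.ModelType.{u, v, w} T) (b : ℕ → M)
    (φ : L.Formula (ℕ ⊕ Unit)) (hφ : ∃ x, φ.Realize (extendBy b x)) :
    ∃ x, φ.Realize (extendBy b x) ∧ IsolatedOver L b x := by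
  by_contra! hcon
  obtain ⟨x₀, hx₀⟩ := hφ
  obtain ⟨A, hA, _⟩ := exists_countable_elementarySubstructure (L := L)
    ((countable_range b).insert x₀)
  let b' : ℕ → A := fun n => ⟨b n, hA (mem_insert_of_mem _ (mem_range_self n))⟩
  have hA' : A ⊨ T := inferInstance
  obtain ⟨E, _, e, B, hbB, homit⟩ := exists_elementary_omitting (L := L) b'
  have hE : E ⊨ T := (e.theory_model_iff T).1 hA'
  have hB' : B ⊨ T := inferInstance
  have hBne : Nonempty B := ⟨⟨_, hbB 0⟩⟩
  let N : L.Substructure A := Substructure.closure L (range b')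
  have hbN : ∀ n, b' n ∈ N := fun n => Substructure.subset_closure (mem_range_self n)
  have hN : Nonempty N := ⟨⟨_, hbN 0⟩⟩
  have hNB : N ≤ B.toSubstructure.comap e.toEmbedding.toHom :=
    Substructure.closure_le.2 (range_subset_iff.2 hbB)
  obtain ⟨C, p, q, k, hp, hq⟩ := hT.exists_common_submodel
    (A := Theory.ModelType.of T A) (B := Theory.ModelType.of T B) N.subtype
    ((e.toEmbedding.comp N.subtype).codRestrict B.toSubstructure fun x => hNB x.2)
  let bC : ℕ → C := fun n => k ⟨b' n, hbN n⟩
  have hpb : p ∘ bC = b' := funext fun n => hp _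
  have hqb : B.subtype ∘ q ∘ bC = e ∘ b' := funext fun n => congrArg Subtype.val (hq ⟨b' n, hbN n⟩)
  have hAb : SameType L b' b := A.subtype.sameType b'
  have hCb : SameType L bC b := (hpb ▸ hT.sameType_embedding p bC).trans hAb
  obtain ⟨c, hc⟩ := (hCb.exists_realize_extendBy φ).2 ⟨x₀, hx₀⟩
  have hCA : SameType L (extendBy bC c) (extendBy b' (p c)) := by
    have := hT.sameType_embedding p (extendBy bC c)
    rwa [comp_extendBy, hpb] at this
  have hCE : SameType L (extendBy bC c) (extendBy (e ∘ b') (q c).1) := by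
    have h₁ := hT.sameType_embedding q (extendBy bC c)
    have h₂ := sameType_extendBy B.subtype (q ∘ bC) (q c)
    rw [hqb] at h₂
    rw [comp_extendBy] at h₁
    exact h₁.trans h₂
  have hAM : SameType L (extendBy b' (p c)) (extendBy b (p c).1) :=
    sameType_extendBy A.subtype b' (p c)
  refine homit _ (q c).2 (p c) (fun hiso => ?_) (hCA.symm.trans hCE)
  exact hcon _ ((hCA.trans hAM φ).1 hc) (hiso.map_elementary A.subtype)

end StrongShoenfieldProperty

theorem exists_fin_formula {ι : Type*} [Nonempty ι] (φ : L.Formula (ι ⊕ Unit)) {M : Type*}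
    [L.Structure M] (a : ι → M) :
    ∃ (n : ℕ) (t : Fin n → ι) (φ' : L.Formula (Fin n ⊕ Unit)),
      ∀ x, φ'.Realize (extendBy (a ∘ t) x) ↔ φ.Realize (extendBy a x) := by
  classical
  obtain ⟨n, g, t, hgt⟩ := exists_fin_retraction φ.freeVarFinset.toLeft
  refine ⟨n + 1, t, φ.relabel (Sum.map g id), fun x => ?_⟩
  rw [Formula.realize_relabel, extendBy_comp]
  refine realize_congr_of_eqOn φ ?_
  rintro (i | i) hi
  · simp [extendBy, hgt i (by simpa using hi)]
  · rfl

/-- If the elements of isolated type are dense over all sequences, they are dense over all families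
`a`. If no element satisfying `φ` has isolated type over `a`, then every formula over `a` consistent
with `φ` is split by another formula over `a`, and this remains true over the subfamily indexed by a
countable set `J` closed under the passage from a formula to the parameters of one splitting it. -/
theorem exists_isolatedOver_of_sequences [Countable L.Symbols] {M : Type*} [L.Structure M]
    (hM : ∀ (b : ℕ → M) (φ : L.Formula (ℕ ⊕ Unit)), (∃ x, φ.Realize (extendBy b x)) →
      ∃ x, φ.Realize (extendBy b x) ∧ IsolatedOver L b x)
    {ι : Type*} [Nonempty ι] (a : ι → M) (φ : L.Formula (ι ⊕ Unit))
    (hφ : ∃ x, φ.Realize (extendBy a x)) :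
    ∃ x, φ.Realize (extendBy a x) ∧ IsolatedOver L a x := by
  by_contra! hcon
  have hsplit : ∀ (n : ℕ) (χ : L.Formula (Fin n ⊕ Unit)) (t : Fin n → ι),
      ∃ (m : ℕ) (t' : Fin m → ι) (ψ : L.Formula (Fin m ⊕ Unit)),
        (∃ x, φ.Realize (extendBy a x) ∧ χ.Realize (extendBy (a ∘ t) x)) →
        ∃ x y, χ.Realize (extendBy (a ∘ t) x) ∧ χ.Realize (extendBy (a ∘ t) y) ∧
          ψ.Realize (extendBy (a ∘ t') x) ∧ ¬ψ.Realize (extendBy (a ∘ t') y) := by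
    intro n χ t
    by_cases hx : ∃ x, φ.Realize (extendBy a x) ∧ χ.Realize (extendBy (a ∘ t) x)
    · obtain ⟨x, hφx, hχx⟩ := hx
      have : ∃ ψ : L.Formula (ι ⊕ Unit), ψ.Realize (extendBy a x) ∧
          ∃ y, χ.Realize (extendBy (a ∘ t) y) ∧ ¬ψ.Realize (extendBy a y) := by
        by_contra! h
        refine hcon x hφx ⟨χ.relabel (Sum.map t id), ?_, fun ψ hψ y hy => h ψ hψ y ?_⟩
        · rwa [Formula.realize_relabel, extendBy_comp]
        · rwa [Formula.realize_relabel, extendBy_comp] at hy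
      obtain ⟨ψ, hψ, y, hχy, hψy⟩ := this
      obtain ⟨m, t', ψ', hψ'⟩ := exists_fin_formula ψ a
      exact ⟨m, t', ψ', fun _ => ⟨x, y, hχx, hχy, (hψ' x).2 hψ, fun h => hψy ((hψ' y).1 h)⟩⟩
    · exact ⟨0, Fin.elim0, ⊥, fun h => absurd h hx⟩
  choose m t' ψ hψ using hsplit
  -- `J` is a substructure of `ι` for a countable language of Skolem functions for splitting.
  let F : Language := ⟨fun n => L.Formula (Fin n ⊕ Unit) × ℕ, fun _ => Empty⟩
  let _ : F.Structure ι :=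
    { funMap := fun {n} f t =>
        if h : f.2 < m n f.1 t then t' n f.1 t ⟨f.2, h⟩ else Classical.arbitrary ι
      RelMap := fun r => Empty.elim r }
  have hF : Countable (Σ n, F.Functions n) :=
    inferInstanceAs (Countable (Σ n : ℕ, L.Formula (Fin n ⊕ Unit) × ℕ))
  obtain ⟨n₀, t₀, φ₀, hφ₀⟩ := exists_fin_formula φ a
  let J := Substructure.closure F (insert (Classical.arbitrary ι) (range t₀))
  have hJ : Countable J := ((countable_range t₀).insert _).substructure_closure F
  have hJne : Nonempty J := ⟨⟨_, Substructure.subset_closure (mem_insert _ _)⟩⟩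
  obtain ⟨f, hf⟩ := exists_surjective_nat J
  have hlift : ∀ {n : ℕ} (t : Fin n → ι), (∀ j, t j ∈ J) →
      ∃ r : Fin n → ℕ, (fun k => (f k : ι)) ∘ r = t := by
    intro n t ht
    choose r hr using fun j => hf ⟨t j, ht j⟩
    exact ⟨r, funext fun j => congrArg Subtype.val (hr j)⟩
  let b : ℕ → M := fun k => a (f k)
  have hb : ∀ {n : ℕ} {t : Fin n → ι} {r : Fin n → ℕ}, (fun k => (f k : ι)) ∘ r = t →
      ∀ (χ : L.Formula (Fin n ⊕ Unit)) (x : M),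
        (χ.relabel (Sum.map r id)).Realize (extendBy b x) ↔ χ.Realize (extendBy (a ∘ t) x) := by
    rintro n t r rfl χ x
    rw [Formula.realize_relabel, extendBy_comp]
    rfl
  obtain ⟨r₀, hr₀⟩ := hlift t₀ fun j =>
    Substructure.subset_closure (mem_insert_of_mem _ (mem_range_self j))
  obtain ⟨x₀, hx₀⟩ := hφ
  obtain ⟨x, hx, χ, hχ, hiso⟩ := hM b (φ₀.relabel (Sum.map r₀ id))
    ⟨x₀, (hb hr₀ φ₀ x₀).2 ((hφ₀ x₀).2 hx₀)⟩
  have hφx : φ.Realize (extendBy a x) := (hφ₀ x).1 ((hb hr₀ φ₀ x).1 hx)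
  obtain ⟨n, t, χ', hχ'⟩ := exists_fin_formula χ b
  obtain ⟨y, z, hy, hz, hψy, hψz⟩ := hψ n χ' (fun j => f (t j)) ⟨x, hφx, (hχ' x).2 hχ⟩
  obtain ⟨r, hr⟩ := hlift (t' n χ' fun j => f (t j)) fun j => by
    have := J.fun_mem (n := n) (χ', (j : ℕ)) (fun j => f (t j)) fun j => (f (t j)).2
    change (if h : (j : ℕ) < m n χ' (fun j => f (t j)) then
      t' n χ' (fun j => f (t j)) ⟨j, h⟩ else Classical.arbitrary ι) ∈ J at this
    rwa [dif_pos j.2] at this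
  have hy' : χ.Realize (extendBy b y) := (hχ' y).1 hy
  have hz' : χ.Realize (extendBy b z) := (hχ' z).1 hz
  by_cases hψx : ((ψ n χ' fun j => f (t j)).relabel (Sum.map r id)).Realize (extendBy b x)
  · exact hψz ((hb hr _ z).1 (hiso _ hψx z hz'))
  · have := hiso _ (Formula.realize_not.2 hψx) y hy'
    exact Formula.realize_not.1 this ((hb hr _ y).2 hψy)

end QETests

namespace QETests

open Set

variable {L : FirstOrder.Language.{u, v}} {T : L.Theory}

/-! ### Constructible models -/

section Constructible

variable {N : Type w} {M P : Type w}

/-- The family consisting of `i` and of the elements `c β` for `β < α`. -/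
def initialFamily (i : N → M) (c : Ordinal.{w} → M) (α : Ordinal.{w}) : N ⊕ Iio α → M :=
  Sum.elim i fun β => c β

theorem range_initialFamily (i : N → M) (c : Ordinal.{w} → M) (α : Ordinal.{w}) :
    range (initialFamily i c α) = range i ∪ c '' Iio α := by
  rw [initialFamily, Sum.elim_range, image_eq_range]

variable [L.Structure M] [L.Structure P]

theorem IsolatedOver.of_range_eq {ι κ : Type*} {a : ι → M} {b : κ → M} {x : M}
    (h : IsolatedOver L a x) (hab : range a = range b) : IsolatedOver L b x := by
  choose f hf using fun k => hab.symm ▸ mem_range_self (f := b) k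
  choose g hg using fun j => hab ▸ mem_range_self (f := a) j
  exact h.reindex f g (funext fun k => (hf k).symm) (funext fun j => (hg j).symm)

/-- If isolated types are dense over all families, there is a transfinite sequence whose elements
have isolated types over `i` and their predecessors, and an initial segment of which is an
elementary substructure. -/
theorem exists_construction [Nonempty N]
    (hM : ∀ {ι : Type w} [Nonempty ι] (a : ι → M) (φ : L.Formula (ι ⊕ Unit)),
      (∃ x, φ.Realize (extendBy a x)) → ∃ x, φ.Realize (extendBy a x) ∧ IsolatedOver L a x)
    (i : N → M) : ∃ c : Ordinal.{w} → M,
      (∀ α, IsolatedOver L (initialFamily i c α) (c α)) ∧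
      ∃ (α : Ordinal.{w}) (C : L.ElementarySubstructure M),
        (C : Set M) = range (initialFamily i c α) := by
  classical
  have hpick : ∀ A : Set M, ∃ x, range i ⊆ A → IsolatedOver L (Subtype.val : A → M) x ∧
      (x ∈ A → ∀ y, IsolatedOver L (Subtype.val : A → M) y → y ∈ A) := by
    intro A
    by_cases h : ∃ x ∉ A, IsolatedOver L (Subtype.val : A → M) x
    · obtain ⟨x, hx, hiso⟩ := h
      exact ⟨x, fun _ => ⟨hiso, fun hxA => absurd hxA hx⟩⟩
    · push Not at h
      refine ⟨i (Classical.arbitrary N), fun hA => ⟨?_, fun _ y hy => ?_⟩⟩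
      · exact IsolatedOver.of_mem_range ⟨⟨_, hA (mem_range_self _)⟩, rfl⟩
      · by_contra hyA
        exact h y hyA hy
  choose pick hpick using hpick
  let c : Ordinal.{w} → M := Ordinal.lt_wf.fix fun α c =>
    pick (range i ∪ {x | ∃ (β : Ordinal.{w}) (h : β < α), c β h = x})
  have hc : ∀ α, c α = pick (range (initialFamily i c α)) := by
    intro α
    rw [range_initialFamily]
    refine (Ordinal.lt_wf.fix_eq _ α).trans ?_
    congr 2
    ext x
    exact ⟨fun ⟨β, h, hx⟩ => ⟨β, h, hx⟩, fun ⟨β, h, hx⟩ => ⟨β, h, hx⟩⟩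
  have hi : ∀ α, range i ⊆ range (initialFamily i c α) := fun α => by
    rw [range_initialFamily]
    exact subset_union_left
  refine ⟨c, fun α => ?_, ?_⟩
  · rw [hc]
    exact (hpick _ (hi α)).1.of_range_eq Subtype.range_coe
  · -- The sequence `c` cannot be injective.
    obtain ⟨α, hα⟩ : ∃ α, c α ∈ range (initialFamily i c α) := by
      by_contra! h
      refine not_injective_of_ordinal c fun α β hαβ => ?_
      have aux : ∀ {α β : Ordinal.{w}}, c α = c β → ¬α < β := fun {α β} hαβ hlt => by
        refine h β ?_
        rw [range_initialFamily]
        exact Or.inr ⟨α, hlt, hαβ⟩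
      exact le_antisymm (not_lt.1 (aux hαβ.symm)) (not_lt.1 (aux hαβ))
    have hMD : L.MeetsDefinable (range (initialFamily i c α)) := by
      have : Nonempty (range (initialFamily i c α)) :=
        ⟨⟨_, hi α (mem_range_self (Classical.arbitrary N))⟩⟩
      rw [← Subtype.range_coe (s := range (initialFamily i c α))]
      refine meetsDefinable_range fun ψ hψ => ?_
      obtain ⟨x, hx, hiso⟩ := hM _ ψ hψ
      rw [hc] at hα
      exact ⟨⟨x, (hpick _ (hi α)).2 hα x hiso⟩, hx⟩
    exact ⟨α, hMD.toElementarySubstructure, hMD.closure_eq_self⟩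

/-- A partial elementary map on `i` extends to all of a transfinite sequence whose elements have
isolated types over `i` and their predecessors. -/
theorem exists_sameType_initialFamily [Nonempty P] {i : N → M} {c : Ordinal.{w} → M}
    (hc : ∀ α, IsolatedOver L (initialFamily i c α) (c α)) {g : N → P} (hg : SameType L i g) :
    ∃ d : Ordinal.{w} → P, ∀ α, SameType L (initialFamily i c α) (initialFamily g d α) := by
  classical
  have hpick : ∀ (α : Ordinal.{w}) (b : Iio α → P), ∃ y,
      SameType L (initialFamily i c α) (Sum.elim g b) →
        SameType L (extendBy (initialFamily i c α) (c α)) (extendBy (Sum.elim g b) y) := by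
    intro α b
    by_cases h : SameType L (initialFamily i c α) (Sum.elim g b)
    · obtain ⟨y, hy⟩ := h.exists_extendBy (hc α)
      exact ⟨y, fun _ => hy⟩
    · exact ⟨Classical.arbitrary P, fun h' => absurd h' h⟩
  choose pick hpick using hpick
  let d : Ordinal.{w} → P := Ordinal.lt_wf.fix fun α d => pick α fun β => d β.1 β.2
  have hd : ∀ α, d α = pick α fun β => d β := fun α => Ordinal.lt_wf.fix_eq _ α
  refine ⟨d, fun α => ?_⟩
  induction α using WellFoundedLT.induction with
  | _ α ih =>
    have hext : ∀ β < α,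
        SameType L (extendBy (initialFamily i c β) (c β)) (extendBy (initialFamily g d β) (d β)) :=
      fun β hβ => by
        rw [hd]
        exact hpick β _ (ih β hβ)
    refine sameType_of_forall_fin fun n f => ?_
    by_cases hne : {β : Iio α | ∃ j, f j = Sum.inr β}.Nonempty
    · -- Let `β` be the last stage which occurs in the tuple `f`.
      have hfin : {β : Iio α | ∃ j, f j = Sum.inr β}.Finite := by
        refine (finite_range f).preimage Sum.inr_injective.injOn |>.subset ?_
        rintro β ⟨j, hj⟩
        exact ⟨j, hj⟩
      obtain ⟨β, -, hβ⟩ := exists_max_image _ id hfin hne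
      let ρ : N ⊕ Iio α → (N ⊕ Iio β.1) ⊕ Unit :=
        Sum.elim (fun x => Sum.inl (Sum.inl x)) fun δ =>
          if h : δ.1 < β.1 then Sum.inl (Sum.inr ⟨δ.1, h⟩) else Sum.inr ()
      have hρ : ∀ {Q : Type w} (i : N → Q) (c : Ordinal.{w} → Q),
          extendBy (initialFamily i c β.1) (c β.1) ∘ ρ ∘ f = initialFamily i c α ∘ f := by
        intro Q i c
        funext j
        rcases hfj : f j with x | δ
        · simp [hfj, ρ, extendBy, initialFamily]
        · by_cases hδ : δ < β
          · simp [hfj, ρ, extendBy, initialFamily, hδ]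
          · have : δ = β := le_antisymm (hβ δ ⟨j, hfj⟩) (not_lt.1 hδ)
            subst this
            simp [hfj, ρ, extendBy, initialFamily]
      have := (hext β.1 β.2).comp (ρ ∘ f)
      rwa [hρ, hρ] at this
    · have : ∀ j, ∃ x, f j = Sum.inl x := fun j => by
        rcases hfj : f j with x | β
        · exact ⟨x, rfl⟩
        · exact absurd ⟨β, j, hfj⟩ hne
      choose t ht using this
      obtain rfl : f = Sum.inl ∘ t := funext ht
      exact hg.comp t

end Constructible

/-! ### From the strong Shoenfield property to the van den Dries property -/

namespace StrongShoenfieldProperty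

theorem exists_closure [Countable L.Symbols] (hT : StrongShoenfieldProperty.{u, v, w} T)
    {N : Type w} [L.Structure N] [Nonempty N] (M : Theory.ModelType.{u, v, w} T) (i : N ↪[L] M) :
    ∃ (C : Theory.ModelType.{u, v, w} T) (k : N ↪[L] C), IsTClosure T C k := by
  obtain ⟨c, hc, α, C, hC⟩ := exists_construction (L := L) (M := M)
    (exists_isolatedOver_of_sequences (hT.exists_isolatedOver_sequence M)) i
  have hmem : ∀ x, x ∈ C ↔ x ∈ range (initialFamily i c α) := fun x => Set.ext_iff.1 hC x
  have hCT : C ⊨ T := inferInstance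
  have hCne : Nonempty C := inferInstance
  have hi : ∀ n, i n ∈ C.toSubstructure := fun n => (hmem _).2 ⟨Sum.inl n, rfl⟩
  refine ⟨Theory.ModelType.of T C, i.codRestrict C.toSubstructure hi, fun P g => ?_⟩
  obtain ⟨d, hd⟩ := exists_sameType_initialFamily hc (hT.sameType_of_embeddings i g)
  choose s hs using fun x : C => (hmem x).1 x.2
  have hsame : SameType L (C.toSubstructure.subtype ∘ id) (initialFamily g d α ∘ s) := by
    have := (hd α).comp s
    rwa [show initialFamily i c α ∘ s = C.toSubstructure.subtype ∘ id from funext hs] at this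
  obtain ⟨h, hh⟩ := exists_embedding_of_qf (L := L) (initialFamily g d α ∘ s) fun γ hγ hr =>
    (hsame γ).1 ((hγ.realize_formula_embedding C.toSubstructure.subtype).2 hr)
  refine ⟨h, fun n => (hh _).trans ?_⟩
  exact ((hd α).eq_iff _ (Sum.inl n)).1 (hs ⟨i n, hi n⟩)

theorem vanDenDriesProperty [Countable L.Symbols] (hT : StrongShoenfieldProperty.{u, v, w} T) :
    VanDenDriesProperty.{u, v, w} T where
  exists_closure N _ _ := fun ⟨M, ⟨i⟩⟩ => hT.exists_closure M i
  exists_adjoin_embedding M N hne hN hNtop := by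
    obtain ⟨a, ha⟩ : ∃ a, a ∉ N := by
      by_contra! h
      exact hNtop (eq_top_iff.2 fun x _ => h x)
    -- By model completeness, `M` itself is an elementary extension of `N`.
    exact ⟨a, ha, M, inferInstance, ⟨N.subtype, fun n φ x =>
      hT.realize_embedding (A := Theory.ModelType.of T N) (B := M) φ N.subtype x⟩,
      (adjoin N a).subtype, fun _ => rfl⟩

end StrongShoenfieldProperty

end QETests

theorem theorem2p7 {L : FirstOrder.Language.{u, v}} [Countable L.Symbols] (T : L.Theory) :
    QETests.StrongShoenfieldProperty.{u, v, w} T ↔ QETests.VanDenDriesProperty.{u, v, w} T :=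
  ⟨fun hT => hT.vanDenDriesProperty, fun hT => hT.strongShoenfieldProperty⟩
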